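/- Let $X$ be a separable, infinite-dimensional Banach space over $\mathbb{R}$ or $\mathbb{C}$, and let $\mathcal{B}(X)$ be the algebra of bounded linear operators on $X$. For $T_1,\dots,T_M\in\mathcal{B}(X)$, $M\ge 1$, let $\mathrm{d}\text{-}\mathcal{HC}(T_1,\dots,T_M)$ be the set of all $x\in X$ such that $\{(T_1^nx,\dots,T_M^nx): n\in\mathbb{N}\}$ is dense in $X^M$; call $T_1,\dots,T_M$ densely d-hypercyclic if $\mathrm{d}\text{-}\mathcal{HC}(T_1,\dots,T_M)$ is dense in $X$. A subset of $\mathcal{B}(X)$ is SOT-dense if it is dense in $\mathcal{B}(X)$ for the strong operator topology (the topology of pointwise norm convergence on $X$). Let $N\ge 1$ and let $T_1,\dots,T_N\in\mathcal{B}(X)$ be densely d-hypercyclic. Then the collection $$\mathcal{D}=\{T\in\mathcal{B}(X): T_1,\dots,T_N,T \text{ are densely d-hypercyclic}\}$$ is SOT-dense in $\mathcal{B}(X)$. Moreover, for every countable (possibly finite) linearly independent set $\mathcal{A}\subseteq \mathrm{d}\text{-}\mathcal{HC}(T_1,\dots,T_N)$ there is an SOT-dense subcollection $\mathcal{C}\subseteq\mathcal{D}$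 such that $\mathcal{A}\subseteq \mathrm{d}\text{-}\mathcal{HC}(T_1,\dots,T_N,T)$ for every $T\in\mathcal{C}$. -/

import Mathlib

namespace DisjointHypercyclic

variable {𝕜 X : Type*} [RCLike 𝕜] [NormedAddCommGroup X] [NormedSpace 𝕜 X]

/-- The set of d-hypercyclic vectors of `T 0, …, T (N - 1)`: the vectors `x` for which
`{(T 0 ^ n x, …, T (N - 1) ^ n x) : n ∈ ℕ}` is dense in `X ^ N`. -/
def dHC {N : ℕ} (T : Fin N → X →L[𝕜] X) : Set X :=
  {x | Dense (Set.range fun n : ℕ => fun i : Fin N => (T i ^ n) x)}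

/-- The operators `T 0, …, T (N - 1)` are densely d-hypercyclic. -/
def DenselyDHypercyclic {N : ℕ} (T : Fin N → X →L[𝕜] X) : Prop :=
  Dense (dHC T)

/-- The tuple `T 0, …, T (N - 1), S`. -/
def extend {N : ℕ} (T : Fin N → X →L[𝕜] X) (S : X →L[𝕜] X) : Fin (N + 1) → X →L[𝕜] X :=
  Fin.snoc (α := fun _ => X →L[𝕜] X) T S

/-- A set of bounded operators is SOT-dense if it is dense for the topology of pointwise
convergence on `X`, which Mathlib puts on the type synonym `X →Lₚₜ[𝕜] X`. -/
def SOTDense (S : Set (X →L[𝕜] X)) : Prop :=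
  Dense (ContinuousLinearMap.toPointwiseConvergenceCLM 𝕜 (RingHom.id 𝕜) X X '' S)

end DisjointHypercyclic

namespace DisjointHypercyclic

/-! ### Mixing of `1 + K` through translation of polynomials. -/

section

open Filter Topology Set Polynomial

variable {𝕜 X : Type*} [RCLike 𝕜] [NormedAddCommGroup X] [NormedSpace 𝕜 X]

/-! Fix a mixing operator S and look for the new operator among the conjugates L⁻¹SL, where L runs
over the invertible operators, an open and hence Baire subset of 𝓑(X). For x d-hypercyclic for the
`T i`, the times at which the given orbit visits an open set U form an infinite set. Mixing lets L
be perturbed slightly so that (L⁻¹SL)ⁿx lies in V at one of those times (`dense_setOf_conj_mem`). By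
Baire, densely many L work for countably many x at once (`dense_setOf_subset_dHC_extend`).
Conjugates of a hypercyclic operator are SOT-dense, and conjugation is continuous, so these L give
an SOT-dense set of operators.

S is 1 + K for a triangular weighted backward shift K (`exists_isMixing`). On a backward chain of K,
1 + K acts like q(X) ↦ q(X + 1) on polynomials, where mixing is explicit. -/

/-- `S` is topologically mixing: for all nonempty open `U`, `V`, the iterate `S ^ n` maps some point
of `U` into `V` as soon as `n` is large. -/
def IsMixing (S : X →L[𝕜] X) : Prop :=
  ∀ U V : Set X, IsOpen U → U.Nonempty → IsOpen V → V.Nonempty →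
    ∀ᶠ n : ℕ in atTop, ∃ x ∈ U, (S ^ n) x ∈ V

/-- Used at s = 1/n → 0. No continuity of Φ is needed: only its values on the finitely many
coefficients of `G` enter. -/
theorem continuous_linearMap_eval_C (Φ : 𝕜[X] →ₗ[𝕜] X) (G : 𝕜[X][X]) :
    Continuous fun s : 𝕜 => Φ (G.eval (C s)) := by
  induction G using Polynomial.induction_on' with
  | add p q hp hq =>
    simp only [eval_add, map_add]
    exact hp.add hq
  | monomial n a =>
    have h : ∀ s : 𝕜, Φ ((monomial n a).eval (C s)) = s ^ n • Φ a := fun s => by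
      rw [eval_monomial, ← map_smul, ← C_pow, mul_comm, C_mul']
    simp only [h]
    fun_prop

theorem iterate_apply_eq_comp {S : X →L[𝕜] X} {Φ : 𝕜[X] →ₗ[𝕜] X}
    (hΦ : ∀ q, S (Φ q) = Φ (q.comp (Polynomial.X + 1))) (n : ℕ) (q : 𝕜[X]) :
    (S ^ n) (Φ q) = Φ (q.comp (Polynomial.X + C (n : 𝕜))) := by
  induction n with
  | zero => simp
  | succ n ih =>
    rw [pow_succ', mul_apply_eq_comp, ih, hΦ, comp_assoc]
    congr 2
    simp
    ring

/-- The vectors that are limits of `u n` with `S ^ n (u n) → 0` and of `S ^ n (w n)` with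
`w n → 0`. -/
def mixingSubmodule (S : X →L[𝕜] X) : Submodule 𝕜 X where
  carrier := {v | (∃ u : ℕ → X, Tendsto u atTop (𝓝 v) ∧
      Tendsto (fun n => (S ^ n) (u n)) atTop (𝓝 0)) ∧
    ∃ w : ℕ → X, Tendsto w atTop (𝓝 0) ∧ Tendsto (fun n => (S ^ n) (w n)) atTop (𝓝 v)}
  zero_mem' := ⟨⟨0, tendsto_const_nhds, by simp⟩, ⟨0, tendsto_const_nhds, by simp⟩⟩
  add_mem' := by
    rintro a b ⟨⟨u, hu, hu'⟩, w, hw, hw'⟩ ⟨⟨u₁, hu₁, hu₁'⟩, w₁, hw₁, hw₁'⟩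
    exact ⟨⟨fun n => u n + u₁ n, hu.add hu₁, by simpa using hu'.add hu₁'⟩,
      ⟨fun n => w n + w₁ n, by simpa using hw.add hw₁, by simpa using hw'.add hw₁'⟩⟩
  smul_mem' := by
    rintro c a ⟨⟨u, hu, hu'⟩, w, hw, hw'⟩
    exact ⟨⟨fun n => c • u n, hu.const_smul c, by simpa using hu'.const_smul c⟩,
      ⟨fun n => c • w n, by simpa using hw.const_smul c, by simpa using hw'.const_smul c⟩⟩

theorem isMixing_of_dense_mixingSubmodule {S : X →L[𝕜] X}
    (h : Dense (mixingSubmodule S : Set X)) : IsMixing S := by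
  intro U V hU hU' hV hV'
  obtain ⟨a, haU, ⟨u, hu, hu'⟩, -⟩ := h.inter_open_nonempty U hU hU'
  obtain ⟨b, hbV, -, ⟨w, hw, hw'⟩⟩ := h.inter_open_nonempty V hV hV'
  have h1 : Tendsto (fun n => u n + w n) atTop (𝓝 a) := by simpa using hu.add hw
  have h2 : Tendsto (fun n => (S ^ n) (u n + w n)) atTop (𝓝 b) := by simpa using hu'.add hw'
  filter_upwards [h1.eventually (hU.mem_nhds haU), h2.eventually (hV.mem_nhds hbV)] with n hn hn'
  exact ⟨_, hn, hn'⟩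

theorem apply_X_pow_mem_mixingSubmodule {S : X →L[𝕜] X} {Φ : 𝕜[X] →ₗ[𝕜] X}
    (hΦ : ∀ q, S (Φ q) = Φ (q.comp (Polynomial.X + 1))) (k : ℕ) :
    Φ (Polynomial.X ^ k) ∈ mixingSubmodule S := by
  have key (G : 𝕜[X][X]) :
      Tendsto (fun n : ℕ => Φ (G.eval (C ((n : 𝕜)⁻¹)))) atTop (𝓝 (Φ (G.eval 0))) := by
    have h := (continuous_linearMap_eval_C Φ G).tendsto 0
    rw [C_0] at h
    exact h.comp (tendsto_inv_atTop_nhds_zero_nat (𝕜 := 𝕜))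
  have hC (n : ℕ) (hn : 0 < n) : (C ((n : 𝕜)⁻¹) * C (n : 𝕜) : 𝕜[X]) = 1 := by
    rw [← C_mul, inv_mul_cancel₀ (by exact_mod_cast hn.ne'), C_1]
  -- The witnesses are uₙ = Xᵏ(1 - X/n)ᵏ⁺¹ and wₙ = n⁻¹Xᵏ⁺¹(X/n - 1)ᵏ. Translation by n turns them
  -- into n⁻¹(-X)ᵏ⁺¹(X/n + 1)ᵏ → 0 and Xᵏ(X/n + 1)ᵏ⁺¹ → Xᵏ.
  refine ⟨⟨fun n : ℕ => Φ ((C (Polynomial.X ^ k) *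
      (1 - C Polynomial.X * Polynomial.X) ^ (k + 1) : 𝕜[X][X]).eval (C ((n : 𝕜)⁻¹))), ?_, ?_⟩,
    fun n : ℕ => Φ ((C (Polynomial.X ^ (k + 1)) * Polynomial.X *
      (C Polynomial.X * Polynomial.X - 1) ^ k : 𝕜[X][X]).eval (C ((n : 𝕜)⁻¹))), ?_, ?_⟩
  · have h0 : (C (Polynomial.X ^ k) * (1 - C Polynomial.X * Polynomial.X) ^ (k + 1) :
      𝕜[X][X]).eval 0 = Polynomial.X ^ k := by simp
    have h := key (C (Polynomial.X ^ k) * (1 - C Polynomial.X * Polynomial.X) ^ (k + 1))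
    rwa [h0] at h
  · have h := key (C ((-Polynomial.X) ^ (k + 1)) * Polynomial.X *
      (C Polynomial.X * Polynomial.X + 1) ^ k)
    simp only [eval_mul, eval_X, mul_zero, zero_mul, map_zero] at h
    refine h.congr' ?_
    filter_upwards [eventually_gt_atTop 0] with n hn
    rw [iterate_apply_eq_comp hΦ]
    congr 1
    simp only [eval_mul, eval_pow, eval_sub, eval_add, eval_C, eval_X, eval_one, mul_comp, pow_comp,
      sub_comp, one_comp, X_comp, C_comp]
    have h1 : (1 - (Polynomial.X + C (n : 𝕜)) * C ((n : 𝕜)⁻¹) : 𝕜[X]) =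
        -Polynomial.X * C ((n : 𝕜)⁻¹) := by linear_combination -hC n hn
    have h2 : (Polynomial.X * C ((n : 𝕜)⁻¹) + 1 : 𝕜[X]) =
        C ((n : 𝕜)⁻¹) * (Polynomial.X + C (n : 𝕜)) := by linear_combination -hC n hn
    rw [h1, h2]
    simp only [mul_pow]
    ring
  · have h := key (C (Polynomial.X ^ (k + 1)) * Polynomial.X *
      (C Polynomial.X * Polynomial.X - 1) ^ k)
    simpa only [eval_mul, eval_X, mul_zero, zero_mul, map_zero] using h
  · have h := key (C (Polynomial.X ^ k) * (C Polynomial.X * Polynomial.X + 1) ^ (k + 1))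
    have h0 : (C (Polynomial.X ^ k) * (C Polynomial.X * Polynomial.X + 1) ^ (k + 1) :
      𝕜[X][X]).eval 0 = Polynomial.X ^ k := by simp
    rw [h0] at h
    refine h.congr' ?_
    filter_upwards [eventually_gt_atTop 0] with n hn
    rw [iterate_apply_eq_comp hΦ]
    congr 1
    simp only [eval_mul, eval_pow, eval_sub, eval_add, eval_C, eval_X, eval_one, mul_comp, pow_comp,
      sub_comp, one_comp, X_comp, C_comp]
    have h1 : ((Polynomial.X + C (n : 𝕜)) * C ((n : 𝕜)⁻¹) - 1 : 𝕜[X]) =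
        Polynomial.X * C ((n : 𝕜)⁻¹) := by linear_combination hC n hn
    have h2 : (Polynomial.X * C ((n : 𝕜)⁻¹) + 1 : 𝕜[X]) =
        C ((n : 𝕜)⁻¹) * (Polynomial.X + C (n : 𝕜)) := by linear_combination -hC n hn
    rw [h1, h2]
    simp only [mul_pow]
    ring

theorem apply_mem_mixingSubmodule {S : X →L[𝕜] X} {Φ : 𝕜[X] →ₗ[𝕜] X}
    (hΦ : ∀ q, S (Φ q) = Φ (q.comp (Polynomial.X + 1))) (q : 𝕜[X]) :
    Φ q ∈ mixingSubmodule S := by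
  induction q using Polynomial.induction_on' with
  | add p q hp hq => simpa using add_mem hp hq
  | monomial n a =>
    rw [← smul_X_eq_monomial, map_smul]
    exact Submodule.smul_mem _ _ (apply_X_pow_mem_mixingSubmodule hΦ n)

theorem descPochhammer_succ_comp_X_add_one (R : Type*) [CommRing R] (n : ℕ) :
    (descPochhammer R (n + 1)).comp (Polynomial.X + 1) =
      descPochhammer R (n + 1) + ((n : R) + 1) • descPochhammer R n := by
  rw [descPochhammer_succ_left, mul_comp, comp_assoc, ← descPochhammer_succ_left,
    descPochhammer_succ_right]
  simp only [X_comp, sub_comp, one_comp, add_sub_cancel_right, comp_X, smul_eq_C_mul, map_add,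
    map_natCast, map_one]
  ring

/-- The falling factorials, as a sequence of polynomials of degrees `0, 1, 2, …`. -/
noncomputable def descPochhammerSequence (R : Type*) [CommRing R] [IsDomain R] :
    Polynomial.Sequence R where
  elems' := descPochhammer R
  degree_eq' n := by
    rw [degree_eq_natDegree (monic_descPochhammer R n).ne_zero, descPochhammer_natDegree]

/-- A backward chain for `K` consists of vectors in the mixing subspace of `1 + K`. -/
theorem chain_mem_mixingSubmodule {K : X →L[𝕜] X} {r : ℕ → X} (h0 : K (r 0) = 0)
    (h1 : ∀ j, K (r (j + 1)) = r j) (k : ℕ) : r k ∈ mixingSubmodule (1 + K) := by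
  let b := (descPochhammerSequence 𝕜).basis fun i => by
    change IsUnit (descPochhammer 𝕜 i).leadingCoeff
    simp [(monic_descPochhammer 𝕜 i).leadingCoeff]
  have hb (j : ℕ) : b j = descPochhammer 𝕜 j := Sequence.basis_eq_self _ _ _
  -- Translation adds j + 1 times the j-th falling factorial to the next one; the weight j! absorbs
  -- this factor, so Φ intertwines translation with `1 + K`.
  let Φ : 𝕜[X] →ₗ[𝕜] X := b.constr 𝕜 fun j => (j.factorial : 𝕜) • r j
  have hΦb (j : ℕ) : Φ (descPochhammer 𝕜 j) = (j.factorial : 𝕜) • r j := by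
    rw [← hb, b.constr_basis]
  have Φ0 : Φ 1 = r 0 := by simpa using hΦb 0
  have hΦ : ((1 + K : X →L[𝕜] X) : X →ₗ[𝕜] X) ∘ₗ Φ =
      Φ ∘ₗ (aeval (Polynomial.X + 1 : 𝕜[X])).toLinearMap := by
    refine b.ext fun j => ?_
    simp only [hb, LinearMap.comp_apply, AlgHom.toLinearMap_apply]
    rw [← comp_eq_aeval, ContinuousLinearMap.coe_coe, add_apply,
      one_apply_eq_self]
    cases j with
    | zero => simp [Φ0, h0]
    | succ j =>
      rw [descPochhammer_succ_comp_X_add_one, map_add, map_smul, hΦb, hΦb, map_smul, h1, smul_smul,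
        Nat.factorial_succ]
      push_cast
      rfl
  have := apply_mem_mixingSubmodule (S := 1 + K) (Φ := Φ)
    (fun q => by simpa [comp_eq_aeval] using LinearMap.congr_fun hΦ q) (descPochhammer 𝕜 k)
  rw [hΦb] at this
  exact (Submodule.smul_mem_iff _ (by exact_mod_cast k.factorial_ne_zero)).1 this

theorem isMixing_one_add_of_flag {K : X →L[𝕜] X} {E : ℕ → Submodule 𝕜 X} (hE : E 0 = ⊥)
    (hK : ∀ m, ∀ v ∈ E (m + 1), K v ∈ E m) (hK' : ∀ m, ∀ v ∈ E m, ∃ w ∈ E (m + 1), K w = v)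
    (hd : Dense (⋃ m, (E m : Set X))) : IsMixing (1 + K) := by
  refine isMixing_of_dense_mixingSubmodule (hd.mono (iUnion_subset fun m v hv => ?_))
  choose! σ hσ hσ' using hK'
  let s : ℕ → X := fun i => Nat.rec v (fun i x => σ (m + i) x) i
  have hs (i : ℕ) : s i ∈ E (m + i) := by
    induction i with
    | zero => exact hv
    | succ i ih => exact hσ _ _ ih
  have hs' (i : ℕ) : K (s (i + 1)) = s i := hσ' _ _ (hs i)
  have hKm (m : ℕ) : ∀ v ∈ E m, (K ^ m) v = 0 := by
    induction m with
    | zero => intro v hv; simpa [hE] using hv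
    | succ m ih =>
      intro v hv
      rw [pow_succ, mul_apply_eq_comp]
      exact ih _ (hK _ _ hv)
  have hcomm (i : ℕ) (x : X) : K ((K ^ i) x) = (K ^ i) (K x) := by
    rw [← mul_apply_eq_comp, ← mul_apply_eq_comp, ← pow_succ', pow_succ]
  have hiter (i : ℕ) : (K ^ i) (s i) = v := by
    induction i with
    | zero => rfl
    | succ i ih => rw [pow_succ, mul_apply_eq_comp, hs', ih]
  -- Applying `K ^ m` to the lifts of `v` gives a chain that starts at 0 and has `v` itself at index
  -- `m`.
  have := chain_mem_mixingSubmodule (K := K) (r := fun j => (K ^ m) (s j))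
    (by rw [hcomm, ← hcomm, hKm m (s 0) hv, map_zero]) (fun j => by rw [hcomm, hs']) m
  simpa [hiter] using this

end

section

open Filter Topology Set

variable {𝕜 X : Type*} [RCLike 𝕜] [NormedAddCommGroup X] [NormedSpace 𝕜 X]

/-! ### Construction of a mixing operator. -/

theorem not_dense_of_finiteDimensional (hX : ¬ FiniteDimensional 𝕜 X) (W : Submodule 𝕜 X)
    [FiniteDimensional 𝕜 W] : ¬ Dense (W : Set X) := by
  intro h
  have h1 : (W : Set X) = univ := by
    rw [← (Submodule.closed_of_finiteDimensional W).closure_eq, h.closure_eq]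
  have h2 : W = ⊤ := SetLike.coe_injective h1
  subst h2
  exact hX (Module.Finite.equiv Submodule.topEquiv)

theorem exists_linearIndependent_dense_span (𝕜 X : Type*) [RCLike 𝕜] [NormedAddCommGroup X]
    [NormedSpace 𝕜 X] [TopologicalSpace.SeparableSpace X] (hX : ¬ FiniteDimensional 𝕜 X) :
    ∃ e : ℕ → X, LinearIndependent 𝕜 e ∧ Dense (Submodule.span 𝕜 (range e) : Set X) := by
  obtain ⟨D, hDc, hD⟩ := TopologicalSpace.exists_countable_dense X
  obtain ⟨b, hbD, hspan, hb⟩ := exists_linearIndependent 𝕜 D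
  have hdense : Dense (Submodule.span 𝕜 b : Set X) := by
    rw [hspan]
    exact hD.mono Submodule.subset_span
  have hinf : b.Infinite := by
    intro hfin
    have := FiniteDimensional.span_of_finite 𝕜 hfin
    exact not_dense_of_finiteDimensional hX _ hdense
  have := (hDc.mono hbD).to_subtype
  have := hinf.to_subtype
  obtain ⟨σ⟩ := nonempty_equiv_of_countable (α := ℕ) (β := b)
  refine ⟨fun n => σ n, hb.comp σ σ.injective, ?_⟩
  have : range (fun n => (σ n : X)) = b := by
    rw [show (fun n => (σ n : X)) = Subtype.val ∘ σ from rfl, σ.surjective.range_comp,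
      Subtype.range_coe]
  rwa [this]

theorem exists_dual_apply_eq {ι : Type*} [Finite ι] {e : ι → X} (he : LinearIndependent 𝕜 e)
    (c : ι → 𝕜) : ∃ φ : X →L[𝕜] 𝕜, ∀ i, φ (e i) = c i := by
  classical
  have := Fintype.ofFinite ι
  obtain ⟨φ, hφ⟩ := SeparatingDual.dualMap_surjective_iff.2
    (show Function.Injective (Fintype.linearCombination 𝕜 e) from
      he.fintypeLinearCombination_injective) (Fintype.linearCombination 𝕜 c)
  refine ⟨φ, fun i => ?_⟩
  simpa using LinearMap.congr_fun hφ (Pi.single i 1)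

/-- On every separable infinite-dimensional Banach space there is a mixing operator. -/
theorem exists_isMixing (𝕜 X : Type*) [RCLike 𝕜] [NormedAddCommGroup X]
    [NormedSpace 𝕜 X] [CompleteSpace X] [TopologicalSpace.SeparableSpace X]
    (hX : ¬ FiniteDimensional 𝕜 X) : ∃ S : X →L[𝕜] X, IsMixing S := by
  obtain ⟨e, he, hd⟩ := exists_linearIndependent_dense_span 𝕜 X hX
  -- Triangularity suffices: `φ k` is not controlled on later `e j`.
  have hφ (k : ℕ) : ∃ φ : X →L[𝕜] 𝕜, (∀ j < k, φ (e j) = 0) ∧ φ (e k) = 1 := by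
    obtain ⟨φ, hφ⟩ := exists_dual_apply_eq
      (he.comp (fun i : Fin (k + 1) => (i : ℕ)) Fin.val_injective)
      (fun i => if (i : ℕ) = k then 1 else 0)
    exact ⟨φ, fun j hj => by simpa [hj.ne] using hφ ⟨j, by omega⟩, by simpa using hφ (Fin.last k)⟩
  choose φ hφ hφ' using hφ
  let A (k : ℕ) : X →L[𝕜] X := (φ (k + 1)).smulRight (e k)
  let c (k : ℕ) : 𝕜 := ((2⁻¹ ^ k / (‖A k‖ + 1) : ℝ) : 𝕜)
  have hA (k : ℕ) : 0 < ‖A k‖ + 1 := by positivity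
  have hc (k : ℕ) : c k ≠ 0 := by
    have := hA k
    simp only [c, ne_eq, RCLike.ofReal_eq_zero]
    positivity
  have hsum : Summable fun k => c k • A k := by
    refine Summable.of_norm_bounded (g := fun k => (2⁻¹ : ℝ) ^ k)
      (summable_geometric_of_lt_one (by norm_num) (by norm_num)) fun k => ?_
    have h := hA k
    rw [norm_smul, RCLike.norm_ofReal, abs_of_pos (by positivity), div_mul_eq_mul_div,
      div_le_iff₀ h]
    gcongr
    linarith
  let K : X →L[𝕜] X := ∑' k, c k • A k
  let E (m : ℕ) : Submodule 𝕜 X := Submodule.span 𝕜 (e '' Iio m)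
  have hmem {j m : ℕ} (h : j < m) : e j ∈ E m := Submodule.subset_span ⟨j, h, rfl⟩
  have hmono {m n : ℕ} (h : m ≤ n) : E m ≤ E n :=
    Submodule.span_mono (image_mono (Iio_subset_Iio h))
  have hEφ (m k : ℕ) (hk : m ≤ k) : E m ≤ LinearMap.ker (φ k : X →ₗ[𝕜] 𝕜) := by
    refine Submodule.span_le.2 ?_
    rintro _ ⟨j, hj, rfl⟩
    exact hφ k j (lt_of_lt_of_le hj hk)
  have hKE (m : ℕ) (v : X) (hv : v ∈ E (m + 1)) :
      K v = ∑ k ∈ Finset.range m, (c k * φ (k + 1) v) • e k := by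
    have h1 : HasSum (fun k => (c k • A k) v) (K v) :=
      hsum.hasSum.mapL (ContinuousLinearMap.apply 𝕜 X v)
    refine h1.unique ?_
    have h2 : ∀ k ∉ Finset.range m, (c k • A k) v = 0 := by
      intro k hk
      have : φ (k + 1) v = 0 := hEφ (m + 1) (k + 1) (by simpa using hk) hv
      simp [A, this]
    simpa [A, smul_smul] using hasSum_sum_of_ne_finset_zero h2
  have hKmem (m : ℕ) (v : X) (hv : v ∈ E (m + 1)) : K v ∈ E m := by
    rw [hKE m v hv]
    exact Submodule.sum_mem _ fun k hk => Submodule.smul_mem _ _ (hmem (by simpa using hk))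
  have hsurj (m : ℕ) : E m ≤ (E (m + 1)).map (K : X →ₗ[𝕜] X) := by
    induction m with
    | zero => simp [E]
    | succ m ih =>
      have ih' : E m ≤ (E (m + 1 + 1)).map (K : X →ₗ[𝕜] X) :=
        ih.trans (Submodule.map_mono (hmono (Nat.le_succ _)))
      refine Submodule.span_le.2 ?_
      rintro _ ⟨j, hj, rfl⟩
      rcases (Nat.lt_succ_iff.1 hj).lt_or_eq with hj | rfl
      · exact ih' (hmem hj)
      · have h := hKE (j + 1) (e (j + 1)) (hmem (Nat.lt_succ_self _))
        rw [Finset.sum_range_succ, hφ', mul_one] at h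
        have h3 : c j • e j ∈ (E (j + 1 + 1)).map (K : X →ₗ[𝕜] X) := by
          -- `K (e (j + 1))` is `c j • e j` plus earlier vectors, already in the image by induction.
          rw [← sub_eq_iff_eq_add'.2 h]
          refine sub_mem (Submodule.mem_map_of_mem (hmem (Nat.lt_succ_self _)))
            (Submodule.sum_mem _ fun k hk => Submodule.smul_mem _ _ (ih' (hmem (by simpa using hk))))
        exact (Submodule.smul_mem_iff _ (hc j)).1 h3
  refine ⟨1 + K, isMixing_one_add_of_flag (E := E) (by simp [E]) hKmem
    (fun m v hv => Submodule.mem_map.1 (hsurj m hv)) (hd.mono ?_)⟩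
  have hdir : Directed (· ≤ ·) E := (monotone_nat_of_le_succ fun m => hmono m.le_succ).directed_le
  rw [← Submodule.coe_iSup_of_directed E hdir]
  refine Submodule.span_le.2 ?_
  rintro _ ⟨j, rfl⟩
  exact Submodule.mem_iSup_of_mem (j + 1) (hmem j.lt_succ_self)

/-! ### SOT-density of the conjugates of a hypercyclic operator. -/

theorem inv_apply_self (L : (X →L[𝕜] X)ˣ) (x : X) :
    (↑L⁻¹ : X →L[𝕜] X) ((L : X →L[𝕜] X) x) = x := by
  rw [← mul_apply_eq_comp, L.inv_mul, one_apply_eq_self]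

/-- A linear automorphism of a finite-dimensional subspace extends to an invertible bounded
operator. -/
theorem exists_unit_extending (M : Submodule 𝕜 X) [FiniteDimensional 𝕜 M] (g : M ≃ₗ[𝕜] M) :
    ∃ L : (X →L[𝕜] X)ˣ, ∀ v : M, (L : X →L[𝕜] X) v = g v := by
  obtain ⟨P, hP⟩ := Submodule.ClosedComplemented.of_finiteDimensional M
  -- Acts as `h` on `M` and as the identity on the kernel of `P`.
  let F (h : M ≃ₗ[𝕜] M) : X →L[𝕜] X :=
    1 + M.subtypeL.comp ((LinearMap.toContinuousLinearMap (h : M →ₗ[𝕜] M) - 1).comp P)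
  have hF (h : M ≃ₗ[𝕜] M) (x : X) : F h x = x + (h (P x) - P x : M) := by simp [F]
  have hmul (h h' : M ≃ₗ[𝕜] M) (hh : ∀ v, h (h' v) = v) : F h * F h' = 1 := by
    ext x
    have h1 : P (F h' x) = h' (P x) := by rw [hF, map_add, hP]; abel
    rw [mul_apply_eq_comp, one_apply_eq_self, hF, h1, hh, hF]
    push_cast
    abel
  exact ⟨⟨F g, F g.symm, hmul _ _ g.apply_symm_apply, hmul _ _ g.symm_apply_apply⟩,
    fun v => by simp [hF, hP]⟩

theorem exists_unit_apply_eq {ι : Type*} [Finite ι] {a b : ι → X} (ha : LinearIndependent 𝕜 a)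
    (hb : LinearIndependent 𝕜 b) : ∃ L : (X →L[𝕜] X)ˣ, ∀ i, (L : X →L[𝕜] X) (a i) = b i := by
  let M : Submodule 𝕜 X := Submodule.span 𝕜 (range a ∪ range b)
  have : FiniteDimensional 𝕜 M :=
    FiniteDimensional.span_of_finite 𝕜 ((finite_range a).union (finite_range b))
  let a' (i : ι) : M := ⟨a i, Submodule.subset_span (Or.inl ⟨i, rfl⟩)⟩
  let b' (i : ι) : M := ⟨b i, Submodule.subset_span (Or.inr ⟨i, rfl⟩)⟩
  have ha' : LinearIndependent 𝕜 a' := LinearIndependent.of_comp M.subtype ha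
  have hb' : LinearIndependent 𝕜 b' := LinearIndependent.of_comp M.subtype hb
  obtain ⟨g, hg⟩ := Submodule.exists_linearEquiv_restrict_eq
    ((Module.Basis.span ha').equiv (Module.Basis.span hb') (Equiv.refl ι))
  obtain ⟨L, hL⟩ := exists_unit_extending M g
  refine ⟨L, fun i => ?_⟩
  have h1 := hg (Module.Basis.span ha' i)
  rw [Module.Basis.equiv_apply, Module.Basis.span_apply, Module.Basis.span_apply] at h1
  exact (hL (a' i)).trans (congrArg Subtype.val h1.symm)

/-- At a first dependence, the span of the earlier iterates would be invariant, hence a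
finite-dimensional space containing a dense orbit. -/
theorem linearIndependent_orbit (hX : ¬ FiniteDimensional 𝕜 X) {S : X →L[𝕜] X} {x : X}
    (hx : Dense (range fun n : ℕ => (S ^ n) x)) (n : ℕ) :
    LinearIndependent 𝕜 fun i : Fin n => (S ^ (i : ℕ)) x := by
  induction n with
  | zero => exact linearIndependent_empty_type
  | succ n ih =>
    refine linearIndependent_finSucc'.2 ⟨ih, fun hmem => ?_⟩
    let W : Submodule 𝕜 X := Submodule.span 𝕜 (range fun i : Fin n => (S ^ (i : ℕ)) x)
    have hn : (S ^ n) x ∈ W := hmem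
    have : FiniteDimensional 𝕜 W := FiniteDimensional.span_of_finite 𝕜 (finite_range _)
    have hlt (j : ℕ) (hj : j < n) : (S ^ j) x ∈ W := Submodule.subset_span ⟨⟨j, hj⟩, rfl⟩
    have hSW : W ≤ W.comap (S : X →ₗ[𝕜] X) := by
      refine Submodule.span_le.2 ?_
      rintro _ ⟨i, rfl⟩
      change S ((S ^ (i : ℕ)) x) ∈ W
      rw [← mul_apply_eq_comp, ← pow_succ']
      rcases (Nat.succ_le_of_lt i.2).lt_or_eq with h | h
      · exact hlt _ h
      · rw [← Nat.succ_eq_add_one, h]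
        exact hn
    have horb (k : ℕ) : (S ^ (n + k)) x ∈ W := by
      induction k with
      | zero => exact hn
      | succ k ihk =>
        rw [← add_assoc, pow_succ', mul_apply_eq_comp]
        exact hSW ihk
    refine not_dense_of_finiteDimensional hX W (hx.mono ?_)
    rintro _ ⟨j, rfl⟩
    rcases lt_or_ge j n with h | h
    · exact hlt j h
    · obtain ⟨k, rfl⟩ := Nat.exists_eq_add_of_le h
      exact horb k

theorem exists_linearIndependent_pairs (hX : ¬ FiniteDimensional 𝕜 X) {S : X →L[𝕜] X} {x : X}
    (hx : Dense (range fun n : ℕ => (S ^ n) x)) (r : ℕ) :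
    ∃ e : Fin r → X, LinearIndependent 𝕜 (Sum.elim e fun i => S (e i)) := by
  let p : Fin r ⊕ Fin r → Fin (2 * r) :=
    Sum.elim (fun i => ⟨2 * i, by omega⟩) (fun i => ⟨2 * i + 1, by omega⟩)
  have hp : Function.Injective p := by
    rintro (i | i) (j | j) h <;> simp [p, Fin.ext_iff] at h ⊢ <;> omega
  refine ⟨fun i => (S ^ (2 * (i : ℕ))) x, ?_⟩
  convert! (linearIndependent_orbit hX hx (2 * r)).comp p hp using 1
  ext (i | i)
  · rfl
  · change S ((S ^ (2 * (i : ℕ))) x) = (S ^ (2 * (i : ℕ) + 1)) x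
    rw [pow_succ', mul_apply_eq_comp]

theorem exists_linearIndependent_mkQ (hX : ¬ FiniteDimensional 𝕜 X) (H : Submodule 𝕜 X)
    [FiniteDimensional 𝕜 H] (r : ℕ) :
    ∃ g : Fin r → X, LinearIndependent 𝕜 (H.mkQ ∘ g) := by
  have hQ : ¬ FiniteDimensional 𝕜 (X ⧸ H) := fun _ =>
    hX (Module.Finite.of_submodule_quotient H)
  have hr : Cardinal.aleph0 ≤ Module.rank 𝕜 (X ⧸ H) := by
    rw [← not_lt, Module.rank_lt_aleph0_iff]
    exact hQ
  obtain ⟨g, hg⟩ := exists_linearIndependent_of_le_rank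
    ((Cardinal.natCast_lt_aleph0 (n := r)).le.trans hr)
  choose g' hg' using fun i => H.mkQ_surjective (g i)
  refine ⟨g', ?_⟩
  rwa [show H.mkQ ∘ g' = g from funext hg']

/-- On a finite set, small perturbations of any operator agree with conjugates of a given
hypercyclic operator. -/
theorem exists_conj_apply_eq (hX : ¬ FiniteDimensional 𝕜 X) {S : X →L[𝕜] X} {x : X}
    (hx : Dense (range fun n : ℕ => (S ^ n) x)) (R : X →L[𝕜] X) {I : Set X} (hI : I.Finite) :
    ∃ G : X → X, ∀ δ : 𝕜, δ ≠ 0 → ∃ L : (X →L[𝕜] X)ˣ, ∀ f ∈ I,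
      ((↑L⁻¹ : X →L[𝕜] X) * S * ↑L) f = R f + δ • G f := by
  let W : Submodule 𝕜 X := Submodule.span 𝕜 I
  have : FiniteDimensional 𝕜 W := FiniteDimensional.span_of_finite 𝕜 hI
  let H : Submodule 𝕜 X := W ⊔ W.map (R : X →ₗ[𝕜] X)
  let b := Module.finBasis 𝕜 W
  obtain ⟨g, hg⟩ := exists_linearIndependent_mkQ hX H (Module.finrank 𝕜 W)
  obtain ⟨e, he⟩ := exists_linearIndependent_pairs hX hx (Module.finrank 𝕜 W)
  obtain ⟨G, hG⟩ := LinearMap.exists_extend (b.constr 𝕜 g)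
  refine ⟨G, fun δ hδ => ?_⟩
  have hGb (i) : G (b i) = g i := by
    have := LinearMap.congr_fun hG (b i)
    rwa [b.constr_basis] at this
  let f (i) : H := ⟨b i, Submodule.mem_sup_left (b i).2⟩
  have hf : LinearIndependent 𝕜 f := LinearIndependent.of_comp H.subtype
    (b.linearIndependent.map' W.subtype W.ker_subtype)
  have hg' : LinearIndependent 𝕜 (Submodule.Quotient.mk (p := H) ∘ fun i => R (b i) + δ • g i) := by
    convert! hg.units_smul (fun _ => Units.mk0 δ hδ) using 1
    ext i
    have : H.mkQ (R (b i)) = 0 := (Submodule.Quotient.mk_eq_zero H).2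
      (Submodule.mem_sup_right (Submodule.mem_map_of_mem (b i).2))
    change H.mkQ (R (b i) + δ • g i) = δ • H.mkQ (g i)
    rw [map_add, this, zero_add, map_smul]
  -- Adding δg, with g independent modulo `H`, makes the b and Rb + δg jointly independent, even if
  -- `R` is degenerate. Sending them to e and Se forces L⁻¹SLb = Rb + δg.
  obtain ⟨L, hL⟩ := exists_unit_apply_eq (hf.sumElim_of_quotient _ hg') he
  refine ⟨L, fun v hv => ?_⟩
  have hlin : (((↑L⁻¹ : X →L[𝕜] X) * S * ↑L : X →L[𝕜] X) : X →ₗ[𝕜] X) ∘ₗ W.subtype =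
      ((R : X →ₗ[𝕜] X) + δ • G) ∘ₗ W.subtype := by
    refine b.ext fun i => ?_
    have h1 : (L : X →L[𝕜] X) (b i) = e i := hL (Sum.inl i)
    have h2 : (L : X →L[𝕜] X) (R (b i) + δ • g i) = S (e i) := hL (Sum.inr i)
    change (↑L⁻¹ : X →L[𝕜] X) (S ((L : X →L[𝕜] X) (b i))) = R (b i) + δ • G (b i)
    rw [h1, ← h2, inv_apply_self, hGb]
  exact LinearMap.congr_fun hlin ⟨v, Submodule.subset_span hv⟩

theorem denseRange_toPointwiseConvergenceCLM_conj (hX : ¬ FiniteDimensional 𝕜 X) {S : X →L[𝕜] X}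
    {x : X} (hx : Dense (range fun n : ℕ => (S ^ n) x)) :
    DenseRange fun L : (X →L[𝕜] X)ˣ =>
      ContinuousLinearMap.toPointwiseConvergenceCLM 𝕜 (RingHom.id 𝕜) X X
        ((↑L⁻¹ : X →L[𝕜] X) * S * ↑L) := by
  intro R
  have hind := (PointwiseConvergenceCLM.isEmbedding_coeFn (RingHom.id 𝕜) X X).isInducing
  rw [hind.closure_eq_preimage_closure_image, mem_preimage, mem_closure_iff_nhds]
  intro t ht
  rw [nhds_pi] at ht
  obtain ⟨I, hI, u, hu, hut⟩ := Filter.mem_pi.1 ht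
  obtain ⟨G, hG⟩ := exists_conj_apply_eq hX hx R hI
  have hev : ∀ᶠ δ in 𝓝[≠] (0 : 𝕜), ∀ f ∈ I, R f + δ • G f ∈ u f := by
    refine (eventually_all_finite hI).2 fun f _ => ?_
    have hc : Continuous fun δ : 𝕜 => R f + δ • G f := by fun_prop
    have h0 : Tendsto (fun δ : 𝕜 => R f + δ • G f) (𝓝 0) (𝓝 (R f)) := by
      simpa using hc.tendsto 0
    exact (h0.mono_left nhdsWithin_le_nhds) (hu f)
  obtain ⟨δ, hδ, hδ0⟩ := (hev.and self_mem_nhdsWithin).exists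
  obtain ⟨L, hL⟩ := hG δ hδ0
  refine ⟨_, hut fun f hf => ?_, mem_image_of_mem _ (mem_range_self L)⟩
  exact mem_of_eq_of_mem (hL f hf) (hδ f hf)

/-! ### Baire category in the group of invertible operators. -/

theorem extend_pow_apply {N : ℕ} (T : Fin N → X →L[𝕜] X) (S : X →L[𝕜] X) (n : ℕ) (x : X) :
    (fun i => (extend T S i ^ n) x) =
      Fin.snoc (α := fun _ => X) (fun i => (T i ^ n) x) ((S ^ n) x) := by
  funext i
  refine Fin.lastCases ?_ (fun i => ?_) i <;> simp [extend]

theorem conj_pow_apply (L : (X →L[𝕜] X)ˣ) (S : X →L[𝕜] X) (n : ℕ) (x : X) :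
    (((↑L⁻¹ : X →L[𝕜] X) * S * ↑L) ^ n) x = (↑L⁻¹ : X →L[𝕜] X) ((S ^ n) ((L : X →L[𝕜] X) x)) := by
  rw [Units.conj_pow']
  rfl

theorem ne_zero_of_mem_dHC [Nontrivial X] {N : ℕ} (hN : 1 ≤ N) {T : Fin N → X →L[𝕜] X} {x : X}
    (hx : x ∈ dHC T) : x ≠ 0 := by
  rintro rfl
  have : Nonempty (Fin N) := ⟨⟨0, hN⟩⟩
  obtain ⟨y, hy⟩ := exists_ne (0 : Fin N → X)
  obtain ⟨z, hz, n, rfl⟩ := hx.inter_open_nonempty {0}ᶜ isOpen_compl_singleton ⟨y, hy⟩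
  exact hz (by ext; simp)

/-- The orbit of a d-hypercyclic vector visits every nonempty open set infinitely often. -/
theorem frequently_mem_of_mem_dHC [Nontrivial X] {N : ℕ} (hN : 1 ≤ N) {T : Fin N → X →L[𝕜] X}
    {x : X} (hx : x ∈ dHC T) {U : Set (Fin N → X)} (hU : IsOpen U) (hU' : U.Nonempty) :
    ∃ᶠ n in atTop, (fun i => (T i ^ n) x) ∈ U := by
  have : Nonempty (Fin N) := ⟨⟨0, hN⟩⟩
  have (y : Fin N → X) : NeBot (𝓝[≠] y) := Module.punctured_nhds_neBot 𝕜 (Fin N → X) y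
  rw [frequently_atTop]
  intro n₀
  have hfin : ((fun n i => (T i ^ n) x) '' Iio n₀).Finite := (finite_Iio n₀).image _
  obtain ⟨y, hyU, ⟨n, rfl⟩, hn⟩ := (Dense.sdiff_finite hx hfin).inter_open_nonempty U hU hU'
  exact ⟨n, not_lt.1 fun h => hn ⟨n, h, rfl⟩, hyU⟩

theorem continuous_conj (S : X →L[𝕜] X) :
    Continuous fun L : (X →L[𝕜] X)ˣ => (↑L⁻¹ : X →L[𝕜] X) * S * ↑L :=
  ((Units.continuous_val.comp continuous_inv).mul continuous_const).mul Units.continuous_val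

variable [CompleteSpace X]

/-- A rank-one perturbation of L₀ can send x to any w near L₀x. Mixing, at all large times and so at
one in `I`, supplies such a w with Sⁿw near L₀y, where y ∈ V; then L⁻¹Sⁿw ∈ V. -/
theorem dense_setOf_conj_mem [Nontrivial X] {S : X →L[𝕜] X} (hS : IsMixing S) {x : X} (hx : x ≠ 0)
    {I : Set ℕ} (hI : ∃ᶠ n in atTop, n ∈ I) {V : Set X} (hV : IsOpen V) (hV' : V.Nonempty) :
    Dense {L : (X →L[𝕜] X)ˣ |
      ∃ n ∈ I, (((↑L⁻¹ : X →L[𝕜] X) * S * ↑L) ^ n) x ∈ V} := by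
  obtain ⟨y, hy⟩ := hV'
  obtain ⟨φ, hφ⟩ := SeparatingDual.exists_eq_one (R := 𝕜) hx
  refine dense_iff_inter_open.2 fun O hO hO' => ?_
  obtain ⟨L₀, hL₀⟩ := hO'
  have hcont : Continuous fun p : (X →L[𝕜] X)ˣ × X => (↑p.1⁻¹ : X →L[𝕜] X) p.2 :=
    (Units.continuous_val.comp (continuous_inv.comp continuous_fst)).clm_apply continuous_snd
  have hO2 : (O ×ˢ univ ∩ (fun p : (X →L[𝕜] X)ˣ × X => (↑p.1⁻¹ : X →L[𝕜] X) p.2) ⁻¹' V) ∈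
      𝓝 (L₀, (L₀ : X →L[𝕜] X) y) := by
    refine IsOpen.mem_nhds ((hO.prod isOpen_univ).inter (hV.preimage hcont)) ⟨⟨hL₀, trivial⟩, ?_⟩
    simpa [inv_apply_self] using hy
  rw [nhds_prod_eq] at hO2
  obtain ⟨O', hO', Z, hZ, hOZ⟩ := mem_prod_iff.1 hO2
  let ψ : X → X →L[𝕜] X := fun w => L₀ + φ.smulRight (w - (L₀ : X →L[𝕜] X) x)
  have hψ : Continuous ψ := by
    have : ψ = fun w => L₀ + ContinuousLinearMap.smulRightL 𝕜 X X φ (w - (L₀ : X →L[𝕜] X) x) := rfl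
    rw [this]
    fun_prop
  have hψ0 : ψ ((L₀ : X →L[𝕜] X) x) = L₀ := by ext; simp [ψ]
  have hψx (w : X) : ψ w x = w := by simp [ψ, hφ]
  have hU : ψ ⁻¹' (Units.val '' interior O') ∈ 𝓝 ((L₀ : X →L[𝕜] X) x) := by
    refine ((Units.isOpenMap_val _ isOpen_interior).preimage hψ).mem_nhds ?_
    exact ⟨L₀, mem_interior_iff_mem_nhds.2 hO', hψ0.symm⟩
  obtain ⟨n, ⟨w, hw, hwn⟩, hn⟩ := ((hS _ _ isOpen_interior ⟨_, mem_interior_iff_mem_nhds.2 hU⟩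
    isOpen_interior ⟨_, mem_interior_iff_mem_nhds.2 hZ⟩).and_frequently hI).exists
  obtain ⟨L, hL, hLw⟩ := interior_subset hw
  have hmem := hOZ (mk_mem_prod (interior_subset hL) (interior_subset hwn))
  refine ⟨L, hmem.1.1, n, hn, ?_⟩
  rw [conj_pow_apply, hLw, hψx]
  exact hmem.2

theorem dense_setOf_subset_dHC_extend [TopologicalSpace.SeparableSpace X] [Nontrivial X] {N : ℕ}
    (hN : 1 ≤ N) {T : Fin N → X →L[𝕜] X} {S : X →L[𝕜] X} (hS : IsMixing S) {A : Set X}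
    (hA : A.Countable) (hAT : A ⊆ dHC T) :
    Dense {L : (X →L[𝕜] X)ˣ | A ⊆ dHC (extend T ((↑L⁻¹ : X →L[𝕜] X) * S * ↑L))} := by
  have : BaireSpace (X →L[𝕜] X)ˣ := Units.isOpenEmbedding_val.baireSpace
  have : SecondCountableTopology X := UniformSpace.secondCountable_of_separable X
  obtain ⟨B, hBc, hB0, hB⟩ := TopologicalSpace.exists_countable_basis (Fin (N + 1) → X)
  let G (p : X × Set (Fin (N + 1) → X)) : Set (X →L[𝕜] X)ˣ :=
    ⋃ n : ℕ, {L | Fin.snoc (α := fun _ => X) (fun i => (T i ^ n) p.1)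
      ((((↑L⁻¹ : X →L[𝕜] X) * S * ↑L) ^ n) p.1) ∈ p.2}
  have hG : Dense (⋂ p ∈ A ×ˢ B, G p) := by
    refine dense_biInter_of_isOpen ?_ (hA.prod hBc) ?_
    · rintro ⟨x, W⟩ ⟨hx, hW⟩
      refine isOpen_iUnion fun n => (hB.isOpen hW).preimage ?_
      exact continuous_const.finSnoc
        (((continuous_conj S).pow n).clm_apply continuous_const)
    · rintro ⟨x, W⟩ ⟨hx, hW⟩
      obtain ⟨w, hw⟩ : W.Nonempty := nonempty_iff_ne_empty.2 fun h => hB0 (h ▸ hW)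
      have hcont : Continuous fun q : (Fin N → X) × X => (Fin.snoc (α := fun _ => X) q.1 q.2 :
          Fin (N + 1) → X) := Continuous.finSnoc (A := fun _ => X) continuous_fst continuous_snd
      have hmem : (fun q : (Fin N → X) × X => (Fin.snoc (α := fun _ => X) q.1 q.2 :
          Fin (N + 1) → X)) ⁻¹' W ∈ 𝓝 (Fin.init w, w (Fin.last N)) :=
        ((hB.isOpen hW).preimage hcont).mem_nhds (by simpa using hw)
      obtain ⟨U, V, hU, hwU, hV, hwV, hUV⟩ := mem_nhds_prod_iff'.1 hmem
      refine (dense_setOf_conj_mem hS (ne_zero_of_mem_dHC hN (hAT hx))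
        (frequently_mem_of_mem_dHC hN (hAT hx) hU ⟨_, hwU⟩) hV ⟨_, hwV⟩).mono ?_
      rintro L ⟨n, hn, hnV⟩
      exact mem_iUnion.2 ⟨n, hUV (mk_mem_prod hn hnV)⟩
  refine hG.mono fun L hL x hx => ?_
  refine hB.dense_iff.2 fun W hW _ => ?_
  obtain ⟨n, hn⟩ := mem_iUnion.1 (mem_iInter₂.1 hL (x, W) ⟨hx, hW⟩)
  exact ⟨_, hn, n, extend_pow_apply T _ n x⟩

end

end DisjointHypercyclic

/-! ### Conclusion. -/

open DisjointHypercyclic Set in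
theorem corollary2p4 {𝕜 X : Type*} [RCLike 𝕜]
    [NormedAddCommGroup X] [NormedSpace 𝕜 X] [CompleteSpace X]
    [TopologicalSpace.SeparableSpace X] (hX : ¬ FiniteDimensional 𝕜 X)
    {N : ℕ} (hN : 1 ≤ N) (T : Fin N → X →L[𝕜] X)
    (hT : DisjointHypercyclic.DenselyDHypercyclic T) :
    DisjointHypercyclic.SOTDense {S : X →L[𝕜] X |
      DisjointHypercyclic.DenselyDHypercyclic (DisjointHypercyclic.extend T S)} ∧
    ∀ A : Set X, A.Countable → LinearIndepOn 𝕜 id A → A ⊆ DisjointHypercyclic.dHC T →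
      ∃ C : Set (X →L[𝕜] X),
        C ⊆ {S : X →L[𝕜] X |
          DisjointHypercyclic.DenselyDHypercyclic (DisjointHypercyclic.extend T S)} ∧
        DisjointHypercyclic.SOTDense C ∧
        ∀ S ∈ C, A ⊆ DisjointHypercyclic.dHC (DisjointHypercyclic.extend T S) := by
  have hnt : Nontrivial X := by
    by_contra h
    rw [not_nontrivial_iff_subsingleton] at h
    exact hX inferInstance
  obtain ⟨K, hK⟩ := exists_isMixing 𝕜 X hX
  have : SecondCountableTopology X := UniformSpace.secondCountable_of_separable X
  obtain ⟨D, hDT, hDc, hD⟩ := hT.exists_countable_dense_subset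
  have main (A : Set X) (hA : A.Countable) (hAT : A ⊆ dHC T) :
      ∃ C : Set (X →L[𝕜] X), C ⊆ {S : X →L[𝕜] X | DenselyDHypercyclic (extend T S)} ∧
        SOTDense C ∧ ∀ S ∈ C, A ⊆ dHC (extend T S) := by
    -- Adjoining the dense set `D` to `A` makes every extended tuple densely d-hypercyclic.
    have hdense := dense_setOf_subset_dHC_extend hN hK (hA.union hDc) (union_subset hAT hDT)
    obtain ⟨L₀, hL₀⟩ := hdense.nonempty
    obtain ⟨x, hx⟩ := hD.nonempty
    have horb : Dense (range fun n : ℕ => (K ^ n) ((L₀ : X →L[𝕜] X) x)) := by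
      have hc : Continuous fun y : Fin (N + 1) → X => (L₀ : X →L[𝕜] X) (y (Fin.last N)) := by
        fun_prop
      have hs : Function.Surjective fun y : Fin (N + 1) → X =>
          (L₀ : X →L[𝕜] X) (y (Fin.last N)) := fun z =>
        ⟨fun _ => (↑L₀⁻¹ : X →L[𝕜] X) z, inv_apply_self L₀⁻¹ z⟩
      refine (hs.denseRange.dense_image hc (hL₀ (Or.inr hx))).mono ?_
      rintro _ ⟨_, ⟨n, rfl⟩, rfl⟩
      refine ⟨n, ?_⟩
      simp only [extend, Fin.snoc_last, conj_pow_apply]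
      exact (inv_apply_self L₀⁻¹ _).symm
    have hcont := (ContinuousLinearMap.toPointwiseConvergenceCLM 𝕜 (RingHom.id 𝕜) X X).continuous
    refine ⟨(fun L : (X →L[𝕜] X)ˣ => (↑L⁻¹ : X →L[𝕜] X) * K * ↑L) ''
      {L | A ∪ D ⊆ dHC (extend T ((↑L⁻¹ : X →L[𝕜] X) * K * ↑L))}, ?_, ?_, ?_⟩
    · rintro _ ⟨L, hL, rfl⟩
      exact hD.mono (subset_union_right.trans hL)
    · rw [SOTDense, image_image]
      exact (denseRange_toPointwiseConvergenceCLM_conj hX horb).dense_image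
        (hcont.comp (continuous_conj K)) hdense
    · rintro _ ⟨L, hL, rfl⟩
      exact subset_union_left.trans hL
  refine ⟨?_, fun A hA _ hAT => main A hA hAT⟩
  obtain ⟨C, hC, hC', -⟩ := main ∅ countable_empty (empty_subset _)
  exact hC'.mono (image_mono hC)
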